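/- Let $k$ be a field and let $A$ be a finite-dimensional associative unital $k$-algebra. Let $\mathsf{tors}\,A$ be the complete lattice, ordered by inclusion, of torsion classes of the category $\mathsf{mod}\,A$ of finitely generated left $A$-modules, that is, of classes of modules that contain $0$ and are closed under factor modules, isomorphisms and extensions. For a complete lattice $L$, the arrows $x\to y$ of its Hasse quiver are the pairs such that $x$ covers $y$; a congruence contracts $x\to y$ if it identifies $x$ and $y$. An arrow $q$ forces an arrow $q'$ if every lattice congruence of $L$ that contracts $q$ also contracts $q'$, and $q,q'$ are forcing equivalent if each forces the other. A completely join-irreducible element $j$ (one such that $j=\bigvee S$ implies $j\in S$) is the source of exactly one arrow $j\to j_*$; dually, a completely meet-irreducible element $m$ is the target of exactly one arrow $m^*\to m$. A brick is a module whose endomorphism ring is a division ring. For every arrow $q:\mathcal T\to\mathcal U$ of the Hasse quiver of $\mathsf{tors}\,A$ there is, up to isomorphism, exactly one brick $S_q$ in $\mathcal T\cap\mathcal U^\perp$, where $\mathcal U^\perp=\{X\mid \mathrm{Hom}_A(U,X)=0 \text{ for all } U\in\mathcal U\}$; it is called the label of $q$. The following hold. (a) Two arrows $q,q'$ of the Hasse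 quiver of $\mathsf{tors}\,A$ are forcing equivalent if and only if $S_q\cong S_{q'}$. Moreover, every brick is the label of some arrow, so that $q\mapsto S_q$ induces a bijection from forcing equivalence classes of arrows to isomorphism classes of bricks. (b) The lattice $L=\mathsf{tors}\,A$ is completely congruence uniform, that is: forcing (of the arrows $j\to j_*$) is a partial order on the set of completely join-irreducible elements of $L$, and the map sending a congruence to the set of completely join-irreducible elements $j$ such that it contracts $j\to j_*$ is a bijection from the set of arrow-determined complete congruences of $L$ to the set of those sets of completely join-irreducible elements that are closed under forcing; and the same holds for completely meet-irreducible elements $m$ and the arrows $m^*\to m$. Here a congruence is complete if it is compatible with arbitrary joins and meets, and arrow-determined if, for all $x\le y$, it identifies $x$ and $y$ if and only if it contracts all arrows of the Hasse quiver of the interval $[x,y]$. (c) The maps $j\mapsto S_{j\to j_*}$ and $m\mapsto S_{m^*\to m}$ are bijections from the completely join-irreducible, respectively completely meet-irreducible, elements of $\mathsf{tors}\,A$ to the isomorphism classes of bricks. For every arrow $q:\mathcal T\to\mathcal U$ there is exactly one completely join-irreducible element $\gamma(q)$ such that $\gamma(q)\to\gamma(q)_*$ is forcing equivalent to $q$ (the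 join-irreducible label of $q$), and exactly one completely meet-irreducible element $\mu(q)$ such that $\mu(q)^*\to\mu(q)$ is forcing equivalent to $q$ (the meet-irreducible label of $q$); $\gamma(q)$ is the least torsion class $\mathcal V$ with $\mathcal U\vee\mathcal V=\mathcal T$, and $\mu(q)$ is the greatest torsion class $\mathcal V$ with $\mathcal T\wedge\mathcal V=\mathcal U$. Under the two bijections above, $\gamma(q)$ and $\mu(q)$ both correspond to $S_q$; that is, the brick labelling coincides with the join-irreducible and with the meet-irreducible labelling. -/

import Mathlib

universe u v

/-! ### Hasse quivers, congruences and forcing in complete lattices -/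

/-- An arrow `src → tgt` of the Hasse quiver of `L`: `src` covers `tgt`. -/
@[ext]
structure HasseArrow (L : Type v) [Preorder L] where
  src : L
  tgt : L
  covBy : tgt ⋖ src

section Lattices

variable {L : Type v} [CompleteLattice L]

/-- The congruence `Θ` contracts the arrow `q`. -/
def LatticeCon.Contracts (Θ : LatticeCon L) (q : HasseArrow L) : Prop :=
  Θ.r q.src q.tgt

/-- The arrow `q` forces `q'`: every lattice congruence contracting `q` contracts `q'`. -/
def Forces (q q' : HasseArrow L) : Prop :=
  ∀ Θ : LatticeCon L, Θ.Contracts q → Θ.Contracts q'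

/-- Forcing equivalence of arrows. -/
def ForcingEquiv (q q' : HasseArrow L) : Prop :=
  Forces q q' ∧ Forces q' q

/-- A lattice congruence that is compatible with arbitrary joins and meets. -/
def LatticeCon.IsComplete (Θ : LatticeCon L) : Prop :=
  ∀ (ι : Type v) (x y : ι → L), (∀ i, Θ.r (x i) (y i)) →
    Θ.r (⨆ i, x i) (⨆ i, y i) ∧ Θ.r (⨅ i, x i) (⨅ i, y i)

/-- `Θ` is arrow-determined: for `x ≤ y`, one has `x ≡ y` if and only if `Θ` contracts all arrows
of the Hasse quiver of the interval `[x, y]`. -/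
def LatticeCon.IsArrowDetermined (Θ : LatticeCon L) : Prop :=
  ∀ x y : L, x ≤ y →
    (Θ.r x y ↔ ∀ q : HasseArrow L, x ≤ q.tgt → q.src ≤ y → Θ.Contracts q)

variable (L) in
/-- The set of arrow-determined complete congruences of `L`. -/
def arrowDeterminedCongruences : Set (LatticeCon L) :=
  {Θ | Θ.IsComplete ∧ Θ.IsArrowDetermined}

variable (L) in
/-- The completely join-irreducible elements of `L`. -/
def CJIrr : Type v := {j : L // ∀ S : Set L, j = sSup S → j ∈ S}

variable (L) in
/-- The completely meet-irreducible elements of `L`. -/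
def CMIrr : Type v := {m : L // ∀ S : Set L, m = sInf S → m ∈ S}

/-- The unique arrow `j → j_*` starting at a completely join-irreducible element `j`. -/
def CJIrr.arrow (j : CJIrr L) : HasseArrow L where
  src := j.1
  tgt := sSup (Set.Iio j.1)
  covBy := by
    have hle : sSup (Set.Iio j.1) ≤ j.1 := sSup_le fun _ hx => le_of_lt hx
    have hne : sSup (Set.Iio j.1) ≠ j.1 := fun h =>
      lt_irrefl j.1 (Set.mem_Iio.1 (j.2 _ h.symm))
    exact ⟨lt_of_le_of_ne hle hne, fun _ h1 h2 => not_lt_of_ge (le_sSup (Set.mem_Iio.2 h2)) h1⟩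

/-- The unique arrow `m^* → m` ending at a completely meet-irreducible element `m`. -/
def CMIrr.arrow (m : CMIrr L) : HasseArrow L where
  src := sInf (Set.Ioi m.1)
  tgt := m.1
  covBy := by
    have hle : m.1 ≤ sInf (Set.Ioi m.1) := le_sInf fun _ hx => le_of_lt hx
    have hne : m.1 ≠ sInf (Set.Ioi m.1) := fun h =>
      lt_irrefl m.1 (Set.mem_Ioi.1 (m.2 _ h))
    exact ⟨lt_of_le_of_ne hle hne, fun _ h1 h2 => not_lt_of_ge (sInf_le (Set.mem_Ioi.2 h1)) h2⟩

theorem CJIrr.arrow_unique (j : CJIrr L) (q : HasseArrow L) (h : q.src = j.1) : q = j.arrow := by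
  refine HasseArrow.ext h ?_
  have h1 : q.tgt ≤ j.arrow.tgt := le_sSup (show q.tgt < j.1 from h ▸ q.covBy.lt)
  refine (q.covBy.eq_or_eq h1 (h ▸ j.arrow.covBy.le)).elim Eq.symm fun h2 => ?_
  exact absurd (h2.trans h) j.arrow.covBy.lt.ne

theorem CMIrr.arrow_unique (m : CMIrr L) (q : HasseArrow L) (h : q.tgt = m.1) : q = m.arrow := by
  refine HasseArrow.ext ?_ h
  have h1 : m.arrow.src ≤ q.src := sInf_le (show m.1 < q.src from h ▸ q.covBy.lt)
  refine (q.covBy.eq_or_eq (h ▸ m.arrow.covBy.le) h1).elim (fun h2 => ?_) Eq.symm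
  exact absurd (h2.trans h) m.arrow.covBy.lt.ne'

/-- A set `I` is closed under the relation `r`: if `a ∈ I` and `r a b`, then `b ∈ I`. -/
def IsForcingIdeal {X : Type v} (r : X → X → Prop) (I : Set X) : Prop :=
  ∀ a ∈ I, ∀ b, r a b → b ∈ I

variable (L) in
/-- `L` is completely congruence uniform: forcing is a partial order on the completely
join-irreducible elements, and sending a congruence to the set of completely join-irreducible
elements that it contracts is a bijection from arrow-determined complete congruences to sets of
completely join-irreducible elements closed under forcing; and likewise for completely
meet-irreducible elements. -/
def IsCompletelyCongruenceUniform : Prop :=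
  (IsPartialOrder (CJIrr L) (fun j j' => Forces j.arrow j'.arrow) ∧
    Set.BijOn (fun (Θ : LatticeCon L) => {j : CJIrr L | Θ.Contracts j.arrow})
      (arrowDeterminedCongruences L)
      {I | IsForcingIdeal (fun j j' : CJIrr L => Forces j.arrow j'.arrow) I}) ∧
  (IsPartialOrder (CMIrr L) (fun m m' => Forces m.arrow m'.arrow) ∧
    Set.BijOn (fun (Θ : LatticeCon L) => {m : CMIrr L | Θ.Contracts m.arrow})
      (arrowDeterminedCongruences L)
      {I | IsForcingIdeal (fun m m' : CMIrr L => Forces m.arrow m'.arrow) I})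

/-- `γ` is the join-irreducible labelling of the Hasse quiver of `L`: `γ q` is the unique completely
join-irreducible element `j` such that `j → j_*` is forcing equivalent to `q`. -/
def IsJoinIrreducibleLabelling (γ : HasseArrow L → CJIrr L) : Prop :=
  ∀ (q : HasseArrow L) (j : CJIrr L), ForcingEquiv j.arrow q ↔ j = γ q

/-- `μ` is the meet-irreducible labelling of the Hasse quiver of `L`: `μ q` is the unique completely
meet-irreducible element `m` such that `m^* → m` is forcing equivalent to `q`. -/
def IsMeetIrreducibleLabelling (μ : HasseArrow L → CMIrr L) : Prop :=
  ∀ (q : HasseArrow L) (m : CMIrr L), ForcingEquiv m.arrow q ↔ m = μ q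

end Lattices

/-! ### Torsion classes and bricks -/

section Modules

variable (A : Type u) [Ring A]

/-- A torsion class in the category of finitely generated left `A`-modules: it contains the zero
modules and is closed under factor modules (hence under isomorphisms) and extensions. -/
@[ext]
structure TorsionClass where
  carrier : Set (FGModuleCat.{u} A)
  zero_mem : ∀ M : FGModuleCat.{u} A, Subsingleton M → M ∈ carrier
  quotient_mem : ∀ (M N : FGModuleCat.{u} A) (f : M →ₗ[A] N), Function.Surjective f →
    M ∈ carrier → N ∈ carrier
  extension_mem : ∀ (M N P : FGModuleCat.{u} A) (f : M →ₗ[A] N) (g : N →ₗ[A] P),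
    Function.Injective f → Function.Exact f g → Function.Surjective g →
    M ∈ carrier → P ∈ carrier → N ∈ carrier

variable {A}

namespace TorsionClass

/-- Torsion classes are ordered by inclusion. -/
instance : PartialOrder (TorsionClass A) :=
  PartialOrder.lift carrier fun _ _ h => TorsionClass.ext h

/-- The meet of a set of torsion classes is their intersection. -/
instance : InfSet (TorsionClass A) where
  sInf S :=
    { carrier := {M | ∀ T ∈ S, M ∈ T.carrier}
      zero_mem := fun M hM T _ => T.zero_mem M hM
      quotient_mem := fun M N f hf hM T hT => T.quotient_mem M N f hf (hM T hT)
      extension_mem := fun M N P f g hf hfg hg hM hP T hT =>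
        T.extension_mem M N P f g hf hfg hg (hM T hT) (hP T hT) }

theorem isGLB_sInf (S : Set (TorsionClass A)) : IsGLB S (sInf S) :=
  ⟨fun T hT _ hM => hM T hT, fun _ hU _ hM _ hT => hU hT hM⟩

/-- The complete lattice of torsion classes; joins are the meets of all upper bounds. -/
instance : CompleteLattice (TorsionClass A) :=
  completeLatticeOfInf (TorsionClass A) isGLB_sInf

/-- The right orthogonal class of `T`: the modules `X` with `Hom(M, X) = 0` for all `M ∈ T`. -/
def perp (T : TorsionClass A) : Set (FGModuleCat.{u} A) :=
  {X | ∀ M ∈ T.carrier, ∀ f : M →ₗ[A] X, f = 0}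

end TorsionClass

/-- A brick: a module whose endomorphism ring is a division ring. -/
def IsBrick (S : FGModuleCat.{u} A) : Prop :=
  Nontrivial S ∧ ∀ f : Module.End A S, f ≠ 0 → IsUnit f

variable (A) in
/-- The bricks of `A`, as finitely generated modules. -/
abbrev Brick : Type (u + 1) := {S : FGModuleCat.{u} A // IsBrick S}

/-- Isomorphism of bricks. -/
instance brickSetoid : Setoid (Brick A) where
  r S S' := Nonempty (S.1 ≃ₗ[A] S'.1)
  iseqv := ⟨fun _ => ⟨LinearEquiv.refl A _⟩, fun ⟨e⟩ => ⟨e.symm⟩, fun ⟨e⟩ ⟨e'⟩ => ⟨e.trans e'⟩⟩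

variable (A) in
/-- The set of isomorphism classes of bricks of `A`. -/
abbrev BrickClass : Type (u + 1) := Quotient (brickSetoid (A := A))

/-- The set of isomorphism classes of bricks that lie in `T` and in the right orthogonal of `U`. -/
def bricksBetween (U T : TorsionClass A) : Set (BrickClass A) :=
  {B | ∃ S : Brick A, Quotient.mk _ S = B ∧ S.1 ∈ T.carrier ∧ S.1 ∈ U.perp}

/-- `lab` is the brick labelling: for each arrow `q : T → U`, the class `lab q` is the unique
isomorphism class of bricks lying in `T` and in the right orthogonal of `U`. -/
def IsBrickLabelling (lab : HasseArrow (TorsionClass A) → BrickClass A) : Prop :=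
  ∀ q : HasseArrow (TorsionClass A), bricksBetween q.tgt q.src = {lab q}

end Modules

/-! Write `gen S` for the least torsion class containing a brick `S`, and `leftPerp S` for the
modules without nonzero maps to `S`. If an arrow `q` has label `S`, then joining with `q.tgt` and
meeting with `gen S` carry `q` to the pair `gen S ⊓ leftPerp S ≤ gen S` and back. So the label alone
decides which congruences contract `q` (`IsLabel.contracts_iff`).

Labels exist and are unique by a length argument: a nonzero module of minimal length in `q.src`,
torsion-free for `q.tgt`, is a brick, and every other brick there is isomorphic to it. Conversely,
`gen S` and `leftPerp S` are completely join- and meet-irreducible for each brick `S`, and their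
arrows have label `S`.

Forcing separates bricks. For a class of modules closed under submodules and factor modules, having
the same members in it is a lattice congruence (`interCon`). Taking the subquotients of `S'` shows
that a brick forcing `S'` is a subquotient of `S'`. Mutual forcing then gives an isomorphism, by
length.

For uniformity, let `C` be the set of bricks that are not to be contracted, closed under passing to
bricks that force a member. The required congruence identifies torsion classes containing the same
bricks of `C` (`brickCon`). It respects joins because the torsion bricks and the torsion-free bricks
in `C` determine each other; this rests on two applications of Zorn's lemma that find, in an
interval where the status of `S` changes, an arrow forcing `S`. -/

open FGModuleCat (of)

namespace TorsionClass

variable {A : Type u} [Ring A]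

/-! ### Torsion classes and their left orthogonals -/

section Basic

theorem le_def {T U : TorsionClass A} : T ≤ U ↔ ∀ M, M ∈ T.carrier → M ∈ U.carrier := Iff.rfl

theorem mem_of_equiv (T : TorsionClass A) {M N : FGModuleCat.{u} A} (e : M ≃ₗ[A] N)
    (h : M ∈ T.carrier) : N ∈ T.carrier :=
  T.quotient_mem M N e e.surjective h

theorem mem_inf {T U : TorsionClass A} {M : FGModuleCat.{u} A} :
    M ∈ (T ⊓ U).carrier ↔ M ∈ T.carrier ∧ M ∈ U.carrier :=
  ⟨fun h => ⟨h T (by simp), h U (by simp)⟩, fun h V hV => by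
    rcases hV with rfl | rfl
    exacts [h.1, h.2]⟩

theorem mem_sInf {s : Set (TorsionClass A)} {M : FGModuleCat.{u} A} :
    M ∈ (sInf s).carrier ↔ ∀ T ∈ s, M ∈ T.carrier := Iff.rfl

theorem mem_iInf {ι : Sort*} {x : ι → TorsionClass A} {M : FGModuleCat.{u} A} :
    M ∈ (⨅ i, x i).carrier ↔ ∀ i, M ∈ (x i).carrier := by
  simp [iInf, mem_sInf]

/-- The modules without nonzero maps to `S`. -/
def leftPerp (S : FGModuleCat.{u} A) : TorsionClass A where
  carrier := {M | ∀ f : M →ₗ[A] S, f = 0}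
  zero_mem M _ f := by ext x; simp [Subsingleton.elim x 0]
  quotient_mem M N g hg hM f := by
    ext y
    obtain ⟨x, rfl⟩ := hg y
    exact LinearMap.congr_fun (hM (f ∘ₗ g)) x
  extension_mem M N P i p _ hip hp hM hP f := by
    have h1 : ∀ x, f (i x) = 0 := LinearMap.congr_fun (hM (f ∘ₗ i))
    have hk : LinearMap.ker p ≤ LinearMap.ker f := fun y hy => by
      obtain ⟨x, rfl⟩ := (hip y).1 hy
      exact h1 x
    have h2 := hP ((LinearMap.ker p).liftQ f hk ∘ₗ (p.quotKerEquivOfSurjective hp).symm.toLinearMap)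
    ext y
    have h3 := LinearMap.congr_fun h2 (p y)
    have h4 : (p.quotKerEquivOfSurjective hp).symm (p y) = Submodule.Quotient.mk y := by
      rw [LinearEquiv.symm_apply_eq]; rfl
    simpa [h4] using h3

/-- The smallest torsion class containing `S`. -/
def gen (S : FGModuleCat.{u} A) : TorsionClass A := sInf {T | S ∈ T.carrier}

theorem mem_gen (S : FGModuleCat.{u} A) : S ∈ (gen S).carrier := fun _ hT => hT

@[simp]
theorem gen_le_iff {S : FGModuleCat.{u} A} {T : TorsionClass A} : gen S ≤ T ↔ S ∈ T.carrier :=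
  ⟨fun h => h (mem_gen S), fun h => sInf_le h⟩

theorem mem_leftPerp {M S : FGModuleCat.{u} A} :
    M ∈ (leftPerp S).carrier ↔ ∀ f : M →ₗ[A] S, f = 0 := Iff.rfl

theorem notMem_of_le_leftPerp {T : TorsionClass A} {S : FGModuleCat.{u} A} [Nontrivial S]
    (h : T ≤ leftPerp S) : S ∉ T.carrier := fun hS => by
  obtain ⟨x, hx⟩ := exists_ne (0 : S)
  exact hx (LinearMap.congr_fun (h hS LinearMap.id) x)

theorem le_leftPerp_of_injective {T : TorsionClass A} {M N : FGModuleCat.{u} A} (i : M →ₗ[A] N)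
    (hi : Function.Injective i) (h : T ≤ leftPerp N) : T ≤ leftPerp M := fun X hX f => by
  ext x
  apply hi
  simpa using LinearMap.congr_fun (h hX (i ∘ₗ f)) x

theorem gen_eq_of_equiv {M N : FGModuleCat.{u} A} (e : M ≃ₗ[A] N) : gen M = gen N :=
  le_antisymm (gen_le_iff.2 ((gen N).mem_of_equiv e.symm (mem_gen N)))
    (gen_le_iff.2 ((gen M).mem_of_equiv e (mem_gen M)))

theorem leftPerp_eq_of_equiv {M N : FGModuleCat.{u} A} (e : M ≃ₗ[A] N) :
    leftPerp M = leftPerp N :=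
  le_antisymm (le_leftPerp_of_injective e.symm.toLinearMap e.symm.injective le_rfl)
    (le_leftPerp_of_injective e.toLinearMap e.injective le_rfl)

theorem range_mem (T : TorsionClass A) {M N : FGModuleCat.{u} A} (f : M →ₗ[A] N)
    (h : M ∈ T.carrier) : of A (LinearMap.range f) ∈ T.carrier :=
  T.quotient_mem M (of A (LinearMap.range f)) f.rangeRestrict f.surjective_rangeRestrict h

theorem quotient_submodule_mem (T : TorsionClass A) {M : FGModuleCat.{u} A} (N : Submodule A M)
    (h : M ∈ T.carrier) : of A (M ⧸ N) ∈ T.carrier :=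
  T.quotient_mem M (of A (M ⧸ N)) N.mkQ N.mkQ_surjective h

end Basic

/-! ### Torsion submodules -/

section Torsion

variable [IsNoetherianRing A]

theorem mem_of_submodule (T : TorsionClass A) {M : FGModuleCat.{u} A} (N : Submodule A M)
    (h1 : of A N ∈ T.carrier) (h2 : of A (M ⧸ N) ∈ T.carrier) : M ∈ T.carrier :=
  T.extension_mem (of A N) M (of A (M ⧸ N)) N.subtype N.mkQ N.injective_subtype
    (LinearMap.exact_subtype_mkQ N) N.mkQ_surjective h1 h2

/-- The sum is an image of `N × N'`, which is an extension of `N'` by `N`. -/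
theorem sup_mem (T : TorsionClass A) {M : FGModuleCat.{u} A} {N N' : Submodule A M}
    (h : of A N ∈ T.carrier) (h' : of A N' ∈ T.carrier) :
    of A (N ⊔ N' : Submodule A M) ∈ T.carrier := by
  have hp : of A (N × N') ∈ T.carrier :=
    T.extension_mem (of A N) (of A (N × N')) (of A N') (LinearMap.inl A N N')
      (LinearMap.snd A N N') LinearMap.inl_injective Function.Exact.inl_snd
      LinearMap.snd_surjective h h'
  have hr := T.range_mem (M := of A (N × N')) (N := M) (N.subtype.coprod N'.subtype) hp
  have he : LinearMap.range (N.subtype.coprod N'.subtype) = N ⊔ N' := by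
    rw [LinearMap.range_coprod]; simp
  exact T.mem_of_equiv (LinearEquiv.ofEq _ _ he) hr

/-- Each module has a largest submodule in a given torsion class. -/
theorem exists_isGreatest (T : TorsionClass A) (M : FGModuleCat.{u} A) :
    ∃ N, IsGreatest {N : Submodule A M | of A N ∈ T.carrier} N := by
  obtain ⟨N, hN, hmax⟩ := set_has_maximal_iff_noetherian.2 (inferInstance : IsNoetherian A M)
    {N : Submodule A M | of A N ∈ T.carrier}
    ⟨⊥, T.zero_mem _ (inferInstanceAs (Subsingleton (⊥ : Submodule A M)))⟩
  refine ⟨N, hN, fun N' hN' => ?_⟩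
  by_contra h
  exact hmax _ (T.sup_mem hN hN') (lt_of_le_of_ne le_sup_left fun e => h (e ▸ le_sup_right))

/-- The canonical exact sequence of a torsion pair. -/
theorem exists_torsion_submodule (T : TorsionClass A) (M : FGModuleCat.{u} A) :
    ∃ N : Submodule A M, of A N ∈ T.carrier ∧ T ≤ leftPerp (of A (M ⧸ N)) := by
  obtain ⟨N, hN, hmax⟩ := T.exists_isGreatest M
  refine ⟨N, hN, fun X hX f => ?_⟩
  -- The preimage of the image of `f` is an extension of that image by `N`, hence torsion. As `N` is
  -- the greatest torsion submodule, `K ≤ N`, so `f = 0`.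
  let K : Submodule A M := (LinearMap.range f).comap N.mkQ
  let g : K →ₗ[A] LinearMap.range f := N.mkQ.restrict fun _ h => h
  let i : N →ₗ[A] K := Submodule.inclusion fun x hx =>
    show N.mkQ x ∈ LinearMap.range f by simp [(Submodule.Quotient.mk_eq_zero N).2 hx]
  have hex : Function.Exact i g := fun y => by
    constructor
    · intro h
      have h' : N.mkQ y.1 = 0 := congrArg Subtype.val h
      exact ⟨⟨y.1, (Submodule.Quotient.mk_eq_zero N).1 h'⟩, rfl⟩
    · rintro ⟨x, rfl⟩
      exact Subtype.ext ((Submodule.Quotient.mk_eq_zero N).2 x.2)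
  have hg : Function.Surjective g := fun ⟨y, hy⟩ => by
    obtain ⟨x, rfl⟩ := N.mkQ_surjective y
    exact ⟨⟨x, hy⟩, rfl⟩
  have hK : of A K ∈ T.carrier :=
    T.extension_mem (of A N) (of A K) (of A (LinearMap.range f)) i g
      (Submodule.inclusion_injective _) hex hg hN (T.range_mem f hX)
  have hKN : K ≤ N := hmax hK
  ext x
  obtain ⟨y, hy⟩ := N.mkQ_surjective (f x)
  have : y ∈ K := show N.mkQ y ∈ LinearMap.range f from hy ▸ ⟨x, rfl⟩
  have h0 : N.mkQ y = 0 := (Submodule.Quotient.mk_eq_zero N).2 (hKN this)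
  exact hy.symm.trans h0

theorem mem_of_subsingleton_quotient (T : TorsionClass A) {M : FGModuleCat.{u} A}
    {N : Submodule A M} (h : of A N ∈ T.carrier) (h' : Subsingleton (M ⧸ N)) : M ∈ T.carrier :=
  T.mem_of_submodule N h (T.zero_mem _ h')

theorem exists_submodule_ne_bot {T : TorsionClass A} {S : FGModuleCat.{u} A}
    (h : ¬ T ≤ leftPerp S) : ∃ N : Submodule A S, N ≠ ⊥ ∧ of A N ∈ T.carrier := by
  simp only [le_def, mem_leftPerp, not_forall] at h
  obtain ⟨X, hX, f, hf⟩ := h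
  exact ⟨LinearMap.range f, fun h0 => hf (LinearMap.range_eq_bot.1 h0), T.range_mem f hX⟩

theorem not_le_leftPerp_of_submodule {T : TorsionClass A} {S : FGModuleCat.{u} A}
    {N : Submodule A S} (h0 : N ≠ ⊥) (h : of A N ∈ T.carrier) : ¬ T ≤ leftPerp S := fun hT => by
  have := hT h N.subtype
  exact h0 (by rw [← N.range_subtype, this]; exact LinearMap.range_zero)

end Torsion

end TorsionClass

/-! ### Bricks -/

namespace IsBrick

variable {A : Type u} [Ring A] {S : FGModuleCat.{u} A}

theorem injective (hS : IsBrick S) {f : Module.End A S} (hf : f ≠ 0) : Function.Injective f :=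
  ((Module.End.isUnit_iff f).1 (hS.2 f hf)).injective

theorem surjective (hS : IsBrick S) {f : Module.End A S} (hf : f ≠ 0) : Function.Surjective f :=
  ((Module.End.isUnit_iff f).1 (hS.2 f hf)).surjective

end IsBrick

namespace TorsionClass

variable {A : Type u} [Ring A]

/-- Proper factor modules of a brick have no nonzero maps to it. -/
theorem quotient_mem_leftPerp {S : FGModuleCat.{u} A} (hS : IsBrick S) {N : Submodule A S}
    (hN : N ≠ ⊥) : of A (S ⧸ N) ∈ (leftPerp S).carrier := fun f => by
  by_contra hf
  have hne : f ∘ₗ N.mkQ ≠ 0 := fun h => hf <| by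
    ext y
    exact LinearMap.congr_fun h y
  obtain ⟨x, hx, hx0⟩ := N.exists_mem_ne_zero_of_ne_bot hN
  refine hx0 (hS.injective hne ?_)
  have h0 : N.mkQ x = 0 := (Submodule.Quotient.mk_eq_zero N).2 hx
  rw [map_zero, LinearMap.comp_apply, h0]
  exact map_zero f

variable [IsArtinianRing A]

/-- A class of modules closed under images of its maps and containing a nonzero module contains a
brick of minimal length among its nonzero modules. -/
theorem exists_isBrick (P : FGModuleCat.{u} A → Prop)
    (hP : ∀ (M N : FGModuleCat.{u} A) (f : M →ₗ[A] N), P M → P N → P (of A (LinearMap.range f)))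
    (M : FGModuleCat.{u} A) (hM : P M) (hM0 : Nontrivial M) :
    ∃ S, IsBrick S ∧ P S ∧
      ∀ N : FGModuleCat.{u} A, P N → Nontrivial N → Module.length A S ≤ Module.length A N := by
  obtain ⟨S, ⟨hS, hS0⟩, hmin⟩ := (InvImage.wf (fun M : FGModuleCat.{u} A => Module.length A M)
    wellFounded_lt).has_min {M | P M ∧ Nontrivial M} ⟨M, hM, hM0⟩
  refine ⟨S, ⟨hS0, fun f hf => ?_⟩, hS, fun N hN hN0 => not_lt.1 (hmin N ⟨hN, hN0⟩)⟩
  -- The image of a nonzero endomorphism again satisfies `P`, so minimal length makes it all of `S`.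
  have hr : LinearMap.range f = ⊤ := by
    by_contra h
    refine hmin (of A (LinearMap.range f)) ⟨hP S S f hS hS, ?_⟩ (Submodule.length_lt h)
    exact Submodule.nontrivial_iff_ne_bot.2 fun h0 => hf (LinearMap.range_eq_bot.1 h0)
  have hs := LinearMap.range_eq_top.1 hr
  exact (Module.End.isUnit_iff f).2 ⟨IsNoetherian.injective_of_surjective_endomorphism f hs, hs⟩

/-- A module not in `U` has a nonzero factor module that is torsion-free for `U`. -/
theorem exists_quotient_of_notMem {U : TorsionClass A} {M : FGModuleCat.{u} A}
    (hM : M ∉ U.carrier) :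
    ∃ N : Submodule A M, Nontrivial (M ⧸ N) ∧ U ≤ leftPerp (of A (M ⧸ N)) := by
  obtain ⟨N, hN, hU⟩ := U.exists_torsion_submodule M
  refine ⟨N, ?_, hU⟩
  by_contra h
  exact hM (U.mem_of_subsingleton_quotient hN (not_nontrivial_iff_subsingleton.1 h))

end TorsionClass

/-! ### Labels of arrows -/

namespace TorsionClass

variable {A : Type u} [Ring A]

/-- A brick in `q.src` that is torsion-free for `q.tgt`. -/
structure IsLabel (q : HasseArrow (TorsionClass A)) (S : FGModuleCat.{u} A) : Prop where
  isBrick : IsBrick S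
  mem_src : S ∈ q.src.carrier
  tgt_le : q.tgt ≤ leftPerp S

theorem _root_.IsBrick.notMem_leftPerp {S : FGModuleCat.{u} A} (hS : IsBrick S) :
    S ∉ (leftPerp S).carrier :=
  haveI := hS.1
  notMem_of_le_leftPerp le_rfl

namespace IsLabel

variable {q : HasseArrow (TorsionClass A)} {S : FGModuleCat.{u} A}

theorem notMem_tgt (h : IsLabel q S) : S ∉ q.tgt.carrier :=
  fun hS => h.isBrick.notMem_leftPerp (h.tgt_le hS)

theorem tgt_sup_gen (h : IsLabel q S) : q.tgt ⊔ gen S = q.src :=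
  (q.covBy.eq_or_eq le_sup_left (sup_le q.covBy.le (gen_le_iff.2 h.mem_src))).resolve_left
    fun e => h.notMem_tgt (gen_le_iff.1 (e ▸ le_sup_right))

theorem src_inf_leftPerp (h : IsLabel q S) : q.src ⊓ leftPerp S = q.tgt :=
  (q.covBy.eq_or_eq (le_inf q.covBy.le h.tgt_le) inf_le_left).resolve_right
    fun e => h.isBrick.notMem_leftPerp ((inf_eq_left.1 e) h.mem_src)

/-- The right-hand side no longer depends on `q`, so all arrows labelled `S` are compared with one
and the same pair. -/
theorem gen_inf_tgt (h : IsLabel q S) : gen S ⊓ q.tgt = gen S ⊓ leftPerp S := by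
  rw [← h.src_inf_leftPerp, ← inf_assoc, inf_eq_left.2 (gen_le_iff.2 h.mem_src)]

/-- A congruence contracts `q` if and only if it contracts the arrow from the torsion class
generated by the label of `q`. -/
theorem contracts_iff (h : IsLabel q S) (Θ : LatticeCon (TorsionClass A)) :
    Θ.Contracts q ↔ Θ.r (gen S) (gen S ⊓ leftPerp S) := by
  constructor
  · intro hq
    have := Θ.inf (Θ.refl (gen S)) hq
    rwa [inf_eq_left.2 (gen_le_iff.2 h.mem_src), h.gen_inf_tgt] at this
  · intro hS
    have := Θ.sup (Θ.refl q.tgt) hS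
    rwa [h.tgt_sup_gen, ← h.gen_inf_tgt, sup_eq_left.2 inf_le_right] at this

theorem of_equiv (h : IsLabel q S) {S' : FGModuleCat.{u} A} (hS' : IsBrick S') (e : S ≃ₗ[A] S') :
    IsLabel q S' :=
  ⟨hS', q.src.mem_of_equiv e h.mem_src, h.tgt_le.trans (leftPerp_eq_of_equiv e).le⟩

/-- Nonzero modules in `q.src` that are torsion-free for `q.tgt` receive a nonzero map from the
label. -/
theorem exists_hom_ne_zero (h : IsLabel q S) {M : FGModuleCat.{u} A} [Nontrivial M]
    (hM : M ∈ q.src.carrier) (hM' : q.tgt ≤ leftPerp M) : ∃ f : S →ₗ[A] M, f ≠ 0 := by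
  by_contra! h0
  refine notMem_of_le_leftPerp (T := q.src) ?_ hM
  rw [← h.tgt_sup_gen]
  exact sup_le hM' (gen_le_iff.2 h0)

theorem src_eq_gen {j : CJIrr (TorsionClass A)} (h : IsLabel j.arrow S) :
    j.1 = gen S := by
  have h1 : j.1 = sSup {j.arrow.tgt, gen S} := by rw [sSup_pair]; exact h.tgt_sup_gen.symm
  exact (j.2 _ h1).resolve_left j.arrow.covBy.lt.ne'

theorem tgt_eq_leftPerp {m : CMIrr (TorsionClass A)} (h : IsLabel m.arrow S) :
    m.1 = leftPerp S := by
  have h1 : m.1 = sInf {m.arrow.src, leftPerp S} := by rw [sInf_pair]; exact h.src_inf_leftPerp.symm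
  exact (m.2 _ h1).resolve_left m.arrow.covBy.lt.ne

end IsLabel

variable [IsArtinianRing A]

/-- The modules in `q.src` that are torsion-free for `q.tgt` are closed under images of maps between
them, since an image is both a factor module and a submodule. Minimality of length is recorded
because uniqueness of the label rests on it. -/
theorem exists_isLabel_minimal (q : HasseArrow (TorsionClass A)) :
    ∃ S, IsLabel q S ∧ ∀ N : FGModuleCat.{u} A, N ∈ q.src.carrier → q.tgt ≤ leftPerp N →
      Nontrivial N → Module.length A S ≤ Module.length A N := by
  obtain ⟨M, hM, hM'⟩ := Set.not_subset.1 (fun h => q.covBy.lt.not_ge h :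
    ¬ q.src.carrier ⊆ q.tgt.carrier)
  obtain ⟨N, hN0, hN⟩ := exists_quotient_of_notMem hM'
  obtain ⟨S, hS, hS', hmin⟩ := exists_isBrick (fun M => M ∈ q.src.carrier ∧ q.tgt ≤ leftPerp M)
    (fun M N f hM hN => ⟨q.src.range_mem f hM.1,
      le_leftPerp_of_injective (LinearMap.range f).subtype Subtype.val_injective hN.2⟩)
    (of A (M ⧸ N)) ⟨q.src.quotient_submodule_mem N hM, hN⟩ hN0
  exact ⟨S, ⟨hS, hS'.1, hS'.2⟩, fun N h1 h2 h3 => hmin N ⟨h1, h2⟩ h3⟩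

namespace IsLabel

variable {q : HasseArrow (TorsionClass A)} {S S' : FGModuleCat.{u} A}

/-- There are nonzero maps `f : S → S'` and `g : S' → S`. Minimal length makes `g` surjective, so `f
∘ₗ g` is nonzero; as `S'` is a brick it is injective, and so is `g`. -/
theorem nonempty_equiv_of_minimal (h : IsLabel q S) (hmin : ∀ N : FGModuleCat.{u} A,
    N ∈ q.src.carrier → q.tgt ≤ leftPerp N → Nontrivial N → Module.length A S ≤ Module.length A N)
    (h' : IsLabel q S') : Nonempty (S ≃ₗ[A] S') := by
  have := h.isBrick.1
  have := h'.isBrick.1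
  obtain ⟨f, hf⟩ := h.exists_hom_ne_zero h'.mem_src h'.tgt_le
  obtain ⟨g, hg⟩ := h'.exists_hom_ne_zero h.mem_src h.tgt_le
  have hg' : Function.Surjective g := by
    rw [← LinearMap.range_eq_top]
    by_contra hr
    refine (Submodule.length_lt hr).not_ge (hmin (of A (LinearMap.range g))
      (q.src.range_mem g h'.mem_src) (le_leftPerp_of_injective (LinearMap.range g).subtype
        Subtype.val_injective h.tgt_le) ?_)
    exact Submodule.nontrivial_iff_ne_bot.2 fun h0 => hg (LinearMap.range_eq_bot.1 h0)
  have hne : f ∘ₗ g ≠ 0 := fun h0 => hf <| by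
    ext x
    obtain ⟨y, rfl⟩ := hg' x
    exact LinearMap.congr_fun h0 y
  have hinj : Function.Injective g := by
    have := h'.isBrick.injective hne
    rw [LinearMap.coe_comp] at this
    exact this.of_comp
  exact ⟨(LinearEquiv.ofBijective g ⟨hinj, hg'⟩).symm⟩

theorem nonempty_equiv (h : IsLabel q S) (h' : IsLabel q S') : Nonempty (S ≃ₗ[A] S') := by
  obtain ⟨S₀, h₀, hmin⟩ := exists_isLabel_minimal q
  obtain ⟨e⟩ := h₀.nonempty_equiv_of_minimal hmin h
  obtain ⟨e'⟩ := h₀.nonempty_equiv_of_minimal hmin h'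
  exact ⟨e.symm.trans e'⟩

theorem length_le (h : IsLabel q S) {N : FGModuleCat.{u} A} (hN : N ∈ q.src.carrier)
    (hN' : q.tgt ≤ leftPerp N) (hN0 : Nontrivial N) : Module.length A S ≤ Module.length A N := by
  obtain ⟨S₀, h₀, hmin⟩ := exists_isLabel_minimal q
  obtain ⟨e⟩ := h₀.nonempty_equiv h
  rw [← e.length_eq]
  exact hmin N hN hN' hN0

/-- Proper factor modules of the label of `q` lie in `q.tgt`. -/
theorem quotient_mem_tgt (h : IsLabel q S) {N : Submodule A S} (hN : N ≠ ⊥) :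
    of A (S ⧸ N) ∈ q.tgt.carrier := by
  by_contra hnot
  obtain ⟨K, hK0, hK⟩ := exists_quotient_of_notMem hnot
  have h1 := h.length_le (q.src.quotient_submodule_mem (M := of A (S ⧸ N)) K
    (q.src.quotient_submodule_mem N h.mem_src)) hK hK0
  have h2 : Module.length A ((S ⧸ N) ⧸ K) ≤ Module.length A (S ⧸ N) :=
    Module.length_le_of_surjective K.mkQ K.mkQ_surjective
  exact (Submodule.length_quotient_lt N hN).not_ge (h1.trans h2)

/-- Some module of `V` maps nontrivially to `S`. The image lies in `q.src` and is torsion-free for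
`q.tgt`, so minimal length makes it all of `S`. -/
theorem isLeast_gen (h : IsLabel q S) : IsLeast {T | q.tgt ⊔ T = q.src} (gen S) := by
  refine ⟨h.tgt_sup_gen, fun V (hV : q.tgt ⊔ V = q.src) => gen_le_iff.2 ?_⟩
  have hVS : ¬ V ≤ leftPerp S := fun hle =>
    h.isBrick.notMem_leftPerp ((hV ▸ sup_le h.tgt_le hle : q.src ≤ leftPerp S) h.mem_src)
  obtain ⟨N, hN0, hN⟩ := exists_submodule_ne_bot hVS
  have htop : N = ⊤ := by
    by_contra hr
    exact (Submodule.length_lt hr).not_ge (h.length_le (N := of A N)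
      ((hV ▸ le_sup_right : V ≤ q.src) hN)
      (le_leftPerp_of_injective N.subtype Subtype.val_injective h.tgt_le)
      (Submodule.nontrivial_iff_ne_bot.2 hN0))
  subst htop
  exact V.mem_of_equiv (M := of A (⊤ : Submodule A S)) Submodule.topEquiv hN

/-- Otherwise `V` contains a nonzero submodule of `S`. The corresponding factor module lies in
`q.tgt ≤ V`, so `V` contains `S` by extension. -/
theorem isGreatest_leftPerp (h : IsLabel q S) :
    IsGreatest {U | q.src ⊓ U = q.tgt} (leftPerp S) := by
  refine ⟨h.src_inf_leftPerp, fun V (hV : q.src ⊓ V = q.tgt) => ?_⟩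
  by_contra hVS
  obtain ⟨N, hN0, hN⟩ := exists_submodule_ne_bot hVS
  have hSV : S ∈ V.carrier := V.mem_of_submodule N hN
    ((hV ▸ inf_le_right : q.tgt ≤ V) (h.quotient_mem_tgt hN0))
  exact h.notMem_tgt (hV ▸ mem_inf.2 ⟨h.mem_src, hSV⟩)

end IsLabel

/-! ### Completely irreducible torsion classes -/

section Irreducible

variable {S : FGModuleCat.{u} A}

/-- A nonzero submodule `N` of `S` lying in `U ≤ gen S` receives a nonzero map from `S`. The
composite `S → N → S` is a nonzero endomorphism of a brick, hence surjective, so `N = S`. -/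
theorem le_leftPerp_of_le_gen (hS : IsBrick S) {U : TorsionClass A} (hU : U ≤ gen S)
    (hSU : S ∉ U.carrier) : U ≤ leftPerp S := by
  by_contra hnot
  obtain ⟨N, hN0, hN⟩ := exists_submodule_ne_bot hnot
  have : ∃ f : S →ₗ[A] N, f ≠ 0 := by
    by_contra! h0
    have : Nontrivial (of A N) := Submodule.nontrivial_iff_ne_bot.2 hN0
    exact notMem_of_le_leftPerp (gen_le_iff.2 (show S ∈ (leftPerp (of A N)).carrier from h0))
      (hU hN)
  obtain ⟨f, hf⟩ := this
  have hne : N.subtype ∘ₗ f ≠ 0 := fun h0 => hf <| by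
    ext x
    exact LinearMap.congr_fun h0 x
  exact hSU (U.quotient_mem (of A N) S N.subtype
    (Function.Surjective.of_comp (g := f) (hS.surjective hne)) hN)

/-- `U` contains a nonzero submodule of `S`, and the proper factor module by it already lies in
`leftPerp S`. -/
theorem mem_of_leftPerp_lt (hS : IsBrick S) {U : TorsionClass A} (h : leftPerp S < U) :
    S ∈ U.carrier := by
  obtain ⟨N, hN0, hN⟩ := exists_submodule_ne_bot h.not_ge
  exact U.mem_of_submodule N hN (h.le (quotient_mem_leftPerp hS hN0))

theorem le_of_lt_gen (hS : IsBrick S) {U : TorsionClass A} (hU : U < gen S) :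
    U ≤ gen S ⊓ leftPerp S :=
  le_inf hU.le (le_leftPerp_of_le_gen hS hU.le fun h => hU.not_ge (gen_le_iff.2 h))

/-- The torsion class generated by a brick is completely join-irreducible. -/
def cjirrOfBrick (S : Brick A) : CJIrr (TorsionClass A) :=
  ⟨gen S.1, fun s hs => by
    by_contra hnot
    have : gen S.1 ≤ leftPerp S.1 := by
      conv_lhs => rw [hs]
      exact sSup_le fun U hU => (le_of_lt_gen S.2 (lt_of_le_of_ne (hs ▸ le_sSup hU)
        fun e => hnot (e ▸ hU))).trans inf_le_right
    exact S.2.notMem_leftPerp (gen_le_iff.1 this)⟩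

/-- The left orthogonal of a brick is completely meet-irreducible. -/
def cmirrOfBrick (S : Brick A) : CMIrr (TorsionClass A) :=
  ⟨leftPerp S.1, fun s hs => by
    by_contra hnot
    have : S.1 ∈ (leftPerp S.1).carrier := by
      conv => rw [hs]
      exact fun U hU => mem_of_leftPerp_lt S.2 (lt_of_le_of_ne (hs ▸ sInf_le hU)
        fun e => hnot (e ▸ hU))
    exact S.2.notMem_leftPerp this⟩

theorem isLabel_cjirrOfBrick (S : Brick A) : IsLabel (cjirrOfBrick S).arrow S.1 :=
  ⟨S.2, mem_gen _, sSup_le fun _ hU => (le_of_lt_gen S.2 hU).trans inf_le_right⟩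

theorem isLabel_cmirrOfBrick (S : Brick A) : IsLabel (cmirrOfBrick S).arrow S.1 :=
  ⟨S.2, fun _ hU => mem_of_leftPerp_lt S.2 hU, le_rfl⟩

end Irreducible

end TorsionClass

namespace TorsionClass

variable {A : Type u} [Ring A]

/-! ### Subquotients -/

/-- `M` is a factor module of a submodule of `N`. -/
def IsSubquotient (M N : FGModuleCat.{u} A) : Prop :=
  ∃ (K : Submodule A N) (f : K →ₗ[A] M), Function.Surjective f

theorem IsSubquotient.length_le {M N : FGModuleCat.{u} A} (h : IsSubquotient M N) :
    Module.length A M ≤ Module.length A N := by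
  obtain ⟨K, f, hf⟩ := h
  exact (Module.length_le_of_surjective f hf).trans
    (Module.length_le_of_injective K.subtype K.injective_subtype)

theorem IsSubquotient.of_injective {M N S : FGModuleCat.{u} A} (i : M →ₗ[A] N)
    (hi : Function.Injective i) (h : IsSubquotient N S) : IsSubquotient M S := by
  obtain ⟨K, f, hf⟩ := h
  let K' : Submodule A K := (LinearMap.range i).comap f
  let g : K' →ₗ[A] LinearMap.range i := f.restrict fun _ hx => hx
  have hg : Function.Surjective g := fun ⟨y, hy⟩ => by
    obtain ⟨x, rfl⟩ := hf y
    exact ⟨⟨x, hy⟩, rfl⟩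
  exact ⟨K'.map K.subtype, (LinearEquiv.ofInjective i hi).symm.toLinearMap ∘ₗ g ∘ₗ
    (K.equivSubtypeMap K').symm.toLinearMap, (LinearEquiv.ofInjective i hi).symm.surjective.comp
      (hg.comp (K.equivSubtypeMap K').symm.surjective)⟩

theorem IsSubquotient.of_surjective {M N S : FGModuleCat.{u} A} (p : M →ₗ[A] N)
    (hp : Function.Surjective p) (h : IsSubquotient M S) : IsSubquotient N S :=
  let ⟨K, f, hf⟩ := h
  ⟨K, p ∘ₗ f, hp.comp hf⟩

theorem IsSubquotient.refl (S : FGModuleCat.{u} A) : IsSubquotient S S :=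
  ⟨⊤, Submodule.topEquiv.toLinearMap, Submodule.topEquiv.surjective⟩

/-! ### Arrows of an interval that force a given brick -/

/-- The union of a nonempty chain of torsion classes. -/
def unionOfChain (c : Set (TorsionClass A)) (hc : IsChain (· ≤ ·) c) (h0 : c.Nonempty) :
    TorsionClass A where
  carrier := {M | ∃ T ∈ c, M ∈ T.carrier}
  zero_mem M hM := h0.imp fun T hT => ⟨hT, T.zero_mem M hM⟩
  quotient_mem M N f hf := fun ⟨T, hT, hM⟩ => ⟨T, hT, T.quotient_mem M N f hf hM⟩
  extension_mem M N P f g hf hfg hg := fun ⟨T, hT, hM⟩ ⟨T', hT', hP⟩ =>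
    (hc.total hT hT').elim
      (fun h => ⟨T', hT', T'.extension_mem M N P f g hf hfg hg (h hM) hP⟩)
      (fun h => ⟨T, hT, T.extension_mem M N P f g hf hfg hg hM (h hP)⟩)

theorem exists_mem_of_mem_sSup {c : Set (TorsionClass A)} (hc : IsChain (· ≤ ·) c)
    (h0 : c.Nonempty) {M : FGModuleCat.{u} A} (hM : M ∈ (sSup c).carrier) :
    ∃ T ∈ c, M ∈ T.carrier :=
  (sSup_le fun T hT _ hX => ⟨T, hT, hX⟩ : sSup c ≤ unionOfChain c hc h0) hM

variable [IsArtinianRing A] {S : FGModuleCat.{u} A} {x y : TorsionClass A}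

/-- The torsion submodules of `S` decrease along the chain, so they stabilise because `S` is
Artinian. If all were nonzero, the smallest one would lie in every member of the chain, hence in the
intersection. -/
theorem exists_le_leftPerp_of_sInf_le {c : Set (TorsionClass A)} (hc : IsChain (· ≤ ·) c)
    (h0 : c.Nonempty) (h : sInf c ≤ leftPerp S) : ∃ T ∈ c, T ≤ leftPerp S := by
  by_contra! hnot
  obtain ⟨N, ⟨T, hT, hN⟩, hmin⟩ := IsArtinian.set_has_minimal
    {N : Submodule A S | ∃ T ∈ c, IsGreatest {N : Submodule A S | of A N ∈ T.carrier} N}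
    (h0.elim fun T hT => (T.exists_isGreatest S).imp fun N hN => ⟨T, hT, hN⟩)
  obtain ⟨N', hN'0, hN'⟩ := exists_submodule_ne_bot (hnot T hT)
  have hN0 : N ≠ ⊥ := fun h => hN'0 (le_bot_iff.1 (h ▸ hN.2 hN'))
  refine not_le_leftPerp_of_submodule (T := sInf c) hN0 (fun T' hT' => ?_) h
  rcases hc.total hT hT' with hle | hle
  · exact hle hN.1
  · obtain ⟨K, hK⟩ := T'.exists_isGreatest S
    have hKN : K ≤ N := hN.2 (hle hK.1)
    have : K = N := by
      by_contra hne
      exact hmin K ⟨T', hT', hK⟩ (lt_of_le_of_ne hKN hne)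
    exact this ▸ hK.1

/-- If a brick `S` lies in `y` but not in `x`, then some arrow of `[x, y]` forces the arrows labelled
by `S`. -/
theorem exists_arrow_of_mem (hS : IsBrick S) (hxy : x ≤ y) (hy : S ∈ y.carrier)
    (hx : S ∉ x.carrier) :
    ∃ q : HasseArrow (TorsionClass A), x ≤ q.tgt ∧ q.src ≤ y ∧
      ∀ Θ : LatticeCon (TorsionClass A), Θ.Contracts q → Θ.r (gen S) (gen S ⊓ leftPerp S) := by
  -- Take `w` maximal between `x` and `x ⊔ gen S` without `S`. Anything strictly above `w` in this
  -- range contains `S`, hence equals `x ⊔ gen S`.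
  obtain ⟨w, hxw, ⟨hwy, hSw⟩, hmax⟩ := zorn_le_nonempty₀
    {w : TorsionClass A | w ≤ x ⊔ gen S ∧ S ∉ w.carrier} (fun c hcs hc z hz =>
      ⟨sSup c, ⟨sSup_le fun T hT => (hcs hT).1, fun h =>
        let ⟨T, hT, hST⟩ := exists_mem_of_mem_sSup hc ⟨z, hz⟩ h
        (hcs hT).2 hST⟩, fun T hT => le_sSup hT⟩) x ⟨le_sup_left, hx⟩
  have hcov : w ⋖ x ⊔ gen S := by
    refine ⟨lt_of_le_of_ne hwy fun e => hSw (e ▸ gen_le_iff.1 le_sup_right), fun z hwz hzy => ?_⟩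
    by_cases hSz : S ∈ z.carrier
    · exact hzy.not_ge (sup_le (hxw.trans hwz.le) (gen_le_iff.2 hSz))
    · exact hwz.not_ge (hmax ⟨hzy.le, hSz⟩ hwz.le)
  refine ⟨⟨x ⊔ gen S, w, hcov⟩, hxw, sup_le hxy (gen_le_iff.2 hy), fun Θ hΘ => ?_⟩
  have h1 : Θ.r (gen S) (gen S ⊓ w) := by
    simpa [LatticeCon.Contracts] using Θ.inf (Θ.refl (gen S)) hΘ
  have hle : gen S ⊓ w ≤ gen S ⊓ leftPerp S :=
    le_inf inf_le_left (le_leftPerp_of_le_gen hS inf_le_left fun h => hSw (mem_inf.1 h).2)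
  -- The element `gen S ⊓ w` may lie strictly below `gen S ⊓ leftPerp S`; joining with the latter
  -- repairs this.
  have h2 := Θ.sup h1 (Θ.refl (gen S ⊓ leftPerp S))
  rwa [sup_eq_left.2 inf_le_left, sup_eq_right.2 hle] at h2

/-- If a brick `S` is torsion-free for `x` but not for `y`, then some arrow of `[x, y]` forces the
arrows labelled by `S`. -/
theorem exists_arrow_of_not_le_leftPerp (hS : IsBrick S) (hxy : x ≤ y) (hx : x ≤ leftPerp S)
    (hy : ¬ y ≤ leftPerp S) :
    ∃ q : HasseArrow (TorsionClass A), x ≤ q.tgt ∧ q.src ≤ y ∧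
      ∀ Θ : LatticeCon (TorsionClass A), Θ.Contracts q → Θ.r (gen S) (gen S ⊓ leftPerp S) := by
  -- Dually, `w` is minimal above `y ⊓ leftPerp S` and below `y` among the classes with a nonzero
  -- map to `S`.
  obtain ⟨w, hwy, ⟨hxw, hSw⟩, hmin⟩ := @zorn_le_nonempty₀ (TorsionClass A)ᵒᵈ _
    {w : TorsionClass A | y ⊓ leftPerp S ≤ w ∧ ¬ w ≤ leftPerp S} (fun c hcs hc z hz =>
      ⟨(sInf c : TorsionClass A), ⟨le_sInf fun T hT => (hcs hT).1, fun h =>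
        let ⟨T, hT, hST⟩ := exists_le_leftPerp_of_sInf_le hc.symm ⟨z, hz⟩ h
        (hcs hT).2 hST⟩, fun T hT => sInf_le (α := TorsionClass A) hT⟩) y ⟨inf_le_left, hy⟩
  change TorsionClass A at w
  change w ≤ y at hwy
  have hmin' : ∀ z : TorsionClass A, y ⊓ leftPerp S ≤ z → ¬ z ≤ leftPerp S → z ≤ w → w ≤ z :=
    fun z h1 h2 h3 => hmin ⟨h1, h2⟩ h3
  have hcov : y ⊓ leftPerp S ⋖ w := by
    refine ⟨lt_of_le_of_ne hxw fun e => hSw (e ▸ inf_le_right), fun z hxz hzw => ?_⟩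
    by_cases hSz : z ≤ leftPerp S
    · exact hxz.not_ge (le_inf (hzw.le.trans hwy) hSz)
    · exact hzw.not_ge (hmin' z hxz.le hSz hzw.le)
  refine ⟨⟨w, _, hcov⟩, le_inf hxy hx, hwy, fun Θ hΘ => ?_⟩
  have h1 : Θ.r (w ⊔ leftPerp S) (leftPerp S) := by
    simpa [LatticeCon.Contracts] using Θ.sup hΘ (Θ.refl (leftPerp S))
  have hmem : S ∈ (w ⊔ leftPerp S).carrier :=
    mem_of_leftPerp_lt hS (lt_of_le_of_ne le_sup_right fun e => hSw (e ▸ le_sup_left))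
  have h2 := Θ.inf (Θ.refl (gen S)) h1
  rwa [inf_eq_left.2 (gen_le_iff.2 hmem)] at h2

/-! ### Congruences from classes closed under submodules and factor modules -/

/-- Two torsion classes that contain the same modules of a class `X` closed under submodules and
factor modules have the same torsion-free modules in `X`. -/
theorem le_leftPerp_of_inter_subset {X : Set (FGModuleCat.{u} A)}
    (hsub : ∀ (M N : FGModuleCat.{u} A) (f : M →ₗ[A] N), Function.Injective f → N ∈ X → M ∈ X)
    (h : ∀ M ∈ X, M ∈ y.carrier → M ∈ x.carrier) {M : FGModuleCat.{u} A} (hM : M ∈ X)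
    (hx : x ≤ leftPerp M) : y ≤ leftPerp M := by
  by_contra hnot
  obtain ⟨N, hN0, hN⟩ := exists_submodule_ne_bot hnot
  exact not_le_leftPerp_of_submodule hN0
    (h (of A N) (hsub (of A N) M N.subtype Subtype.val_injective hM) hN) hx

/-- A module of `X` in `y` but not in `x` has a nonzero factor module that is torsion-free for `x`,
hence for `y`, yet lies in `y`. -/
theorem inter_subset_of_le_leftPerp {X : Set (FGModuleCat.{u} A)}
    (hquo : ∀ (M N : FGModuleCat.{u} A) (f : M →ₗ[A] N), Function.Surjective f → M ∈ X → N ∈ X)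
    (h : ∀ M ∈ X, x ≤ leftPerp M → y ≤ leftPerp M) {M : FGModuleCat.{u} A} (hM : M ∈ X)
    (hy : M ∈ y.carrier) : M ∈ x.carrier := by
  by_contra hnot
  obtain ⟨N, hN0, hN⟩ := exists_quotient_of_notMem hnot
  exact notMem_of_le_leftPerp (S := of A (M ⧸ N))
    (h (of A (M ⧸ N)) (hquo M (of A (M ⧸ N)) N.mkQ N.mkQ_surjective hM) hN)
    (y.quotient_submodule_mem N hy)

/-- The congruence identifying torsion classes with the same members in a class of modules closed
under submodules and factor modules. -/
def interCon (X : Set (FGModuleCat.{u} A))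
    (hsub : ∀ (M N : FGModuleCat.{u} A) (f : M →ₗ[A] N), Function.Injective f → N ∈ X → M ∈ X)
    (hquo : ∀ (M N : FGModuleCat.{u} A) (f : M →ₗ[A] N), Function.Surjective f → M ∈ X → N ∈ X) :
    LatticeCon (TorsionClass A) where
  r x y := ∀ M ∈ X, M ∈ x.carrier ↔ M ∈ y.carrier
  iseqv := ⟨fun _ _ _ => Iff.rfl, fun h M hM => (h M hM).symm,
    fun h h' M hM => (h M hM).trans (h' M hM)⟩
  inf h h' M hM := by rw [mem_inf, mem_inf, h M hM, h' M hM]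
  sup {x y z w} h h' := by
    -- Members of a join are hard to describe, but a module is torsion-free for a join exactly when
    -- it is so for both terms. Hence the passage to torsion-free modules and back.
    have key : ∀ {x y z w : TorsionClass A}, (∀ M ∈ X, M ∈ x.carrier ↔ M ∈ y.carrier) →
        (∀ M ∈ X, M ∈ z.carrier ↔ M ∈ w.carrier) → ∀ M ∈ X, M ∈ (x ⊔ z).carrier →
          M ∈ (y ⊔ w).carrier := fun h h' M hM =>
      inter_subset_of_le_leftPerp hquo (fun N hN hle => sup_le
        (le_leftPerp_of_inter_subset hsub (fun M hM => (h M hM).1) hN (le_sup_left.trans hle))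
        (le_leftPerp_of_inter_subset hsub (fun M hM => (h' M hM).1) hN (le_sup_right.trans hle))) hM
    exact fun M hM => ⟨key h h' M hM,
      key (fun M hM => (h M hM).symm) (fun M hM => (h' M hM).symm) M hM⟩

theorem IsSubquotient.nonempty_equiv {M N : FGModuleCat.{u} A} (h : IsSubquotient M N)
    (hle : Module.length A N ≤ Module.length A M) : Nonempty (M ≃ₗ[A] N) := by
  obtain ⟨K, f, hf⟩ := h
  have hK : K = ⊤ := by
    by_contra hK
    exact ((Module.length_le_of_surjective f hf).trans_lt (Submodule.length_lt hK)).not_ge hle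
  subst hK
  have hker : LinearMap.ker f = ⊥ := by
    by_contra h0
    have h1 := Submodule.length_quotient_lt _ h0
    rw [(f.quotKerEquivOfSurjective hf).length_eq, Module.length_top] at h1
    exact h1.not_ge hle
  exact ⟨(LinearEquiv.ofBijective f ⟨LinearMap.ker_eq_bot.1 hker, hf⟩).symm.trans
    Submodule.topEquiv⟩

/-- If `q` forces `q'`, then the label of `q` is a subquotient of the label of `q'`. -/
theorem IsLabel.isSubquotient_of_forces {q q' : HasseArrow (TorsionClass A)}
    {S S' : FGModuleCat.{u} A} (h : IsLabel q S) (h' : IsLabel q' S') (hf : Forces q q') :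
    IsSubquotient S S' := by
  -- This congruence does not contract `q'`, since `S'` tells its ends apart. Were `S` not a
  -- subquotient of `S'`, it would contract `q`: a subquotient of `S'` separating the ends of `q`
  -- would yield a brick label of `q` that is a subquotient of `S'`.
  let Θ : LatticeCon (TorsionClass A) := interCon {M | IsSubquotient M S'}
    (fun _ _ i hi => IsSubquotient.of_injective i hi)
    (fun _ _ p hp => IsSubquotient.of_surjective p hp)
  have hS' : ¬ Θ.Contracts q' := fun hc => h'.notMem_tgt ((hc S' (.refl S')).1 h'.mem_src)
  by_contra hS
  refine hS' (hf Θ fun M hM => ⟨fun hMs => ?_, fun hMt => q.covBy.le hMt⟩)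
  by_contra hMt
  obtain ⟨N, hN0, hN⟩ := exists_quotient_of_notMem hMt
  obtain ⟨S₁, hS₁, ⟨h1, h2, h3⟩, -⟩ := exists_isBrick
    (fun M => M ∈ q.src.carrier ∧ q.tgt ≤ leftPerp M ∧ IsSubquotient M S')
    (fun M N f hM hN => ⟨q.src.range_mem f hM.1,
      le_leftPerp_of_injective (LinearMap.range f).subtype Subtype.val_injective hN.2.1,
      .of_injective (M := of A (LinearMap.range f)) (LinearMap.range f).subtype
        Subtype.val_injective hN.2.2⟩)
    (of A (M ⧸ N)) ⟨q.src.quotient_submodule_mem N hMs, hN,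
      .of_surjective (N := of A (M ⧸ N)) N.mkQ N.mkQ_surjective hM⟩ hN0
  obtain ⟨e⟩ := h.nonempty_equiv ⟨hS₁, h1, h2⟩
  exact hS (.of_surjective e.symm.toLinearMap e.symm.surjective h3)

end TorsionClass

namespace TorsionClass

variable {A : Type u} [Ring A]

/-! ### Forcing between bricks -/

/-- Every congruence contracting the arrows labelled by `S` contracts those labelled by `S'`. -/
def BrickForces (S S' : FGModuleCat.{u} A) : Prop :=
  ∀ Θ : LatticeCon (TorsionClass A),
    Θ.r (gen S) (gen S ⊓ leftPerp S) → Θ.r (gen S') (gen S' ⊓ leftPerp S')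

theorem brickForces_of_equiv {S S' : FGModuleCat.{u} A} (e : S ≃ₗ[A] S') : BrickForces S S' :=
  fun Θ h => by rwa [← gen_eq_of_equiv e, ← leftPerp_eq_of_equiv e]

theorem IsLabel.forces_iff {q q' : HasseArrow (TorsionClass A)} {S S' : FGModuleCat.{u} A}
    (h : IsLabel q S) (h' : IsLabel q' S') : Forces q q' ↔ BrickForces S S' :=
  forall_congr' fun Θ => by rw [h.contracts_iff, h'.contracts_iff]

variable [IsArtinianRing A]

theorem IsLabel.forcingEquiv_iff {q q' : HasseArrow (TorsionClass A)} {S S' : FGModuleCat.{u} A}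
    (h : IsLabel q S) (h' : IsLabel q' S') : ForcingEquiv q q' ↔ Nonempty (S ≃ₗ[A] S') :=
  ⟨fun hf => (h.isSubquotient_of_forces h' hf.1).nonempty_equiv
      (h'.isSubquotient_of_forces h hf.2).length_le,
    fun ⟨e⟩ => ⟨(h.forces_iff h').2 (brickForces_of_equiv e),
      (h'.forces_iff h).2 (brickForces_of_equiv e.symm)⟩⟩

/-! ### The congruence of a set of bricks closed under forcing -/

section BrickCon

/-- `C` contains every brick that forces one of its members. -/
def IsForcingFilter (C : Set (Brick A)) : Prop :=
  ∀ S S' : Brick A, BrickForces S.1 S'.1 → S' ∈ C → S ∈ C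

variable {C : Set (Brick A)} {x y : TorsionClass A}

theorem IsForcingFilter.exists_label (hC : IsForcingFilter C) {S : Brick A} (hS : S ∈ C)
    (h : ∃ q : HasseArrow (TorsionClass A), x ≤ q.tgt ∧ q.src ≤ y ∧
      ∀ Θ : LatticeCon (TorsionClass A), Θ.Contracts q →
        Θ.r (gen S.1) (gen S.1 ⊓ leftPerp S.1)) :
    ∃ S' ∈ C, S'.1 ∈ y.carrier ∧ x ≤ leftPerp S'.1 := by
  obtain ⟨q, hx, hy, hΘ⟩ := h
  obtain ⟨S', hS', -⟩ := exists_isLabel_minimal q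
  exact ⟨⟨S', hS'.isBrick⟩, hC _ _ (fun Θ h => hΘ Θ ((hS'.contracts_iff Θ).2 h)) hS,
    hy hS'.mem_src, hx.trans hS'.tgt_le⟩

/-- Otherwise an arrow of `[x ⊓ y, y]` forces `S`. Its label is in `C` and lies in `y`, hence in `x
⊓ y`, for which it is torsion-free. -/
theorem IsForcingFilter.le_leftPerp (hC : IsForcingFilter C)
    (h : ∀ S ∈ C, S.1 ∈ x.carrier ↔ S.1 ∈ y.carrier) {S : Brick A} (hS : S ∈ C)
    (hx : x ≤ leftPerp S.1) : y ≤ leftPerp S.1 := by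
  by_contra hy
  obtain ⟨S', hS', h1, h2⟩ := hC.exists_label hS (exists_arrow_of_not_le_leftPerp S.2
    inf_le_right ((inf_le_left : x ⊓ y ≤ x).trans hx) hy)
  exact S'.2.notMem_leftPerp (h2 (mem_inf.2 ⟨(h S' hS').2 h1, h1⟩))

/-- The same argument in `[x, x ⊔ y]`: the label found there would be torsion-free for `x`, hence
for `x ⊔ y`, in which it lies. -/
theorem IsForcingFilter.mem_of_le_leftPerp (hC : IsForcingFilter C)
    (h : ∀ S ∈ C, x ≤ leftPerp S.1 → y ≤ leftPerp S.1) {S : Brick A} (hS : S ∈ C)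
    (hy : S.1 ∈ y.carrier) : S.1 ∈ x.carrier := by
  by_contra hx
  obtain ⟨S', hS', h1, h2⟩ := hC.exists_label hS (exists_arrow_of_mem S.2
    (le_sup_left : x ≤ x ⊔ y) ((le_sup_right : y ≤ x ⊔ y) hy) hx)
  exact S'.2.notMem_leftPerp ((sup_le h2 (h S' hS' h2) : x ⊔ y ≤ _) h1)

theorem IsForcingFilter.iSup_mem (hC : IsForcingFilter C) {ι : Sort*} {x y : ι → TorsionClass A}
    (h : ∀ i, ∀ S ∈ C, S.1 ∈ (x i).carrier ↔ S.1 ∈ (y i).carrier) :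
    ∀ S ∈ C, S.1 ∈ (⨆ i, x i).carrier ↔ S.1 ∈ (⨆ i, y i).carrier := by
  have key : ∀ {x y : ι → TorsionClass A},
      (∀ i, ∀ S ∈ C, S.1 ∈ (x i).carrier ↔ S.1 ∈ (y i).carrier) →
      ∀ S ∈ C, S.1 ∈ (⨆ i, x i).carrier → S.1 ∈ (⨆ i, y i).carrier := fun {x y} h S hS =>
    hC.mem_of_le_leftPerp (fun S' hS' hle => iSup_le fun i => hC.le_leftPerp
      (fun S hS => (h i S hS).symm) hS' ((le_iSup y i).trans hle)) hS
  exact fun S hS => ⟨key h S hS, key (fun i S hS => (h i S hS).symm) S hS⟩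

/-- The congruence identifying torsion classes that contain the same bricks of `C`. -/
def brickCon (C : Set (Brick A)) (hC : IsForcingFilter C) : LatticeCon (TorsionClass A) where
  r x y := ∀ S ∈ C, S.1 ∈ x.carrier ↔ S.1 ∈ y.carrier
  iseqv := ⟨fun _ _ _ => Iff.rfl, fun h M hM => (h M hM).symm,
    fun h h' M hM => (h M hM).trans (h' M hM)⟩
  inf h h' S hS := by rw [mem_inf, mem_inf, h S hS, h' S hS]
  sup h h' := by
    rw [sup_eq_iSup, sup_eq_iSup]
    exact hC.iSup_mem fun b => by cases b <;> assumption

theorem brickCon_isComplete (hC : IsForcingFilter C) : (brickCon C hC).IsComplete :=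
  fun _ _ _ h => ⟨hC.iSup_mem h, fun S hS => by
    rw [mem_iInf, mem_iInf]; exact forall_congr' fun i => h i S hS⟩

theorem brickCon_isArrowDetermined (hC : IsForcingFilter C) :
    (brickCon C hC).IsArrowDetermined := by
  refine fun x y hxy => ⟨fun h q hx hy S hS =>
    ⟨fun hq => hx ((h S hS).2 (hy hq)), fun hq => q.covBy.le hq⟩, fun h S hS =>
    ⟨fun hx => hxy hx, fun hy => ?_⟩⟩
  by_contra hx
  obtain ⟨q, hxq, hqy, hq⟩ := exists_arrow_of_mem S.2 hxy hy hx
  -- If `q` were contracted, `gen S` and `gen S ⊓ leftPerp S` would contain the same bricks of `C`,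
  -- but `S` lies only in the former.
  exact S.2.notMem_leftPerp (mem_inf.1 ((hq _ (h q hxq hqy) S hS).1 (mem_gen _))).2

/-- If a brick of `C` separates the ends of `q`, an arrow between these ends has its label in `C`.
That label is also a label of `q`, hence isomorphic to `S`. -/
theorem brickCon_contracts_iff (hC : IsForcingFilter C) {q : HasseArrow (TorsionClass A)}
    {S : Brick A} (h : IsLabel q S.1) : (brickCon C hC).Contracts q ↔ S ∉ C := by
  refine ⟨fun hq hS => h.notMem_tgt ((hq S hS).1 h.mem_src), fun hS S' hS' =>
    ⟨fun hsrc => ?_, fun htgt => q.covBy.le htgt⟩⟩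
  by_contra htgt
  obtain ⟨S₁, hS₁, h1, h2⟩ := hC.exists_label hS' (exists_arrow_of_mem S'.2 q.covBy.le hsrc htgt)
  obtain ⟨e⟩ := h.nonempty_equiv ⟨S₁.2, h1, h2⟩
  exact hS (hC _ _ (brickForces_of_equiv e) hS₁)

end BrickCon

/-! ### Congruence uniformity -/

section Uniform

variable {X : Type (u + 1)} {a : X → HasseArrow (TorsionClass A)}

theorem isPartialOrder_forces (ha : ∀ (i j : X) (S : FGModuleCat.{u} A), IsLabel (a i) S →
    IsLabel (a j) S → i = j) : IsPartialOrder X fun i j => Forces (a i) (a j) where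
  refl _ _ h := h
  trans _ _ _ h h' Θ hΘ := h' Θ (h Θ hΘ)
  antisymm i j h h' := by
    obtain ⟨S, hS, -⟩ := exists_isLabel_minimal (a i)
    obtain ⟨S', hS', -⟩ := exists_isLabel_minimal (a j)
    obtain ⟨e⟩ := (hS.forcingEquiv_iff hS').1 ⟨h, h'⟩
    exact ha i j S hS (hS'.of_equiv hS.isBrick e.symm)

/-- If every brick labels an arrow of a family, then arrow-determined complete congruences
correspond to the forcing-closed subfamilies. -/
theorem bijOn_arrowDeterminedCongruences (ha : ∀ S : Brick A, ∃ i, IsLabel (a i) S.1) :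
    Set.BijOn (fun Θ : LatticeCon (TorsionClass A) => {i : X | Θ.Contracts (a i)})
      (arrowDeterminedCongruences (TorsionClass A))
      {I | IsForcingIdeal (fun i j : X => Forces (a i) (a j)) I} := by
  refine ⟨fun Θ _ i hi j hij => hij Θ hi, fun Θ hΘ Θ' hΘ' h => ?_, fun I hI => ?_⟩
  · have hq : ∀ q, Θ.Contracts q ↔ Θ'.Contracts q := fun q => by
      obtain ⟨S, hS, -⟩ := exists_isLabel_minimal q
      obtain ⟨i, hi⟩ := ha ⟨S, hS.isBrick⟩
      have := Set.ext_iff.1 h i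
      rw [hS.contracts_iff, hS.contracts_iff, ← hi.contracts_iff, ← hi.contracts_iff]
      exact this
    -- Two elements are congruent if and only if their meet and join are, so arrow-determined
    -- congruences are known from the arrows they contract.
    have hr : ∀ x y, Θ.r x y ↔ Θ'.r x y := fun x y => by
      rw [← Θ.r_inf_sup_iff, ← Θ'.r_inf_sup_iff, hΘ.2 _ _ inf_le_sup, hΘ'.2 _ _ inf_le_sup]
      simp only [hq]
    cases Θ; cases Θ'
    congr 1
    exact Setoid.ext hr
  -- The bricks to be kept apart are those labelling no arrow of `I`; closure of `I` under forcing
  -- makes them a forcing filter.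
  · have hC : IsForcingFilter {S : Brick A | ∀ i ∈ I, ¬ IsLabel (a i) S.1} := by
      intro S S' hSS' hS' i hi hiS
      obtain ⟨j, hj⟩ := ha S'
      exact hS' j (hI i hi j ((hiS.forces_iff hj).2 hSS')) hj
    refine ⟨brickCon _ hC, ⟨brickCon_isComplete hC, brickCon_isArrowDetermined hC⟩, ?_⟩
    ext i
    obtain ⟨S, hS, -⟩ := exists_isLabel_minimal (a i)
    simp only [Set.mem_ofPred_eq, brickCon_contracts_iff hC (S := ⟨S, hS.isBrick⟩) hS, not_forall,
      not_not]
    exact ⟨fun ⟨j, hj, hjS⟩ => hI j hj i ((hjS.forces_iff hS).2 fun _ h => h),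
      fun hi => ⟨i, hi, hS⟩⟩

theorem isCompletelyCongruenceUniform : IsCompletelyCongruenceUniform (TorsionClass A) :=
  ⟨⟨isPartialOrder_forces fun _ _ _ hi hj => Subtype.ext (hi.src_eq_gen.trans hj.src_eq_gen.symm),
    bijOn_arrowDeterminedCongruences fun S => ⟨_, isLabel_cjirrOfBrick S⟩⟩,
   ⟨isPartialOrder_forces fun _ _ _ hi hj =>
      Subtype.ext (hi.tgt_eq_leftPerp.trans hj.tgt_eq_leftPerp.symm),
    bijOn_arrowDeterminedCongruences fun S => ⟨_, isLabel_cmirrOfBrick S⟩⟩⟩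

end Uniform

end TorsionClass

/-! ### The three labellings and their comparison -/

open TorsionClass

theorem mainTheorem4 (k : Type*) (A : Type u) [Field k] [Ring A] [Algebra k A]
    [FiniteDimensional k A] :
    ∃ (lab : HasseArrow (TorsionClass A) → BrickClass A)
      (γ : HasseArrow (TorsionClass A) → CJIrr (TorsionClass A))
      (μ : HasseArrow (TorsionClass A) → CMIrr (TorsionClass A)),
      -- the brick labelling, the join-irreducible labelling and the meet-irreducible labelling
      -- exist (each of them is determined by its defining property)
      IsBrickLabelling lab ∧ IsJoinIrreducibleLabelling γ ∧ IsMeetIrreducibleLabelling μ ∧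
      -- (a)
      (∀ q q' : HasseArrow (TorsionClass A), lab q = lab q' ↔ ForcingEquiv q q') ∧
      Function.Surjective lab ∧
      -- (b)
      IsCompletelyCongruenceUniform (TorsionClass A) ∧
      -- (c)
      Function.Bijective (fun j : CJIrr (TorsionClass A) => lab j.arrow) ∧
      (∀ q : HasseArrow (TorsionClass A), lab (γ q).arrow = lab q ∧
        IsLeast {T : TorsionClass A | q.tgt ⊔ T = q.src} (γ q).1) ∧
      Function.Bijective (fun m : CMIrr (TorsionClass A) => lab m.arrow) ∧
      (∀ q : HasseArrow (TorsionClass A), lab (μ q).arrow = lab q ∧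
        IsGreatest {U : TorsionClass A | q.src ⊓ U = q.tgt} (μ q).1) := by
  have : IsArtinianRing A := IsArtinianRing.of_finite k A
  have hex : ∀ q : HasseArrow (TorsionClass A), ∃ S : Brick A, IsLabel q S.1 := fun q =>
    let ⟨S, hS, _⟩ := exists_isLabel_minimal q
    ⟨⟨S, hS.isBrick⟩, hS⟩
  choose s hs using hex
  let lab : HasseArrow (TorsionClass A) → BrickClass A := fun q => Quotient.mk _ (s q)
  have lab_eq : ∀ (q) (S : Brick A), IsLabel q S.1 → lab q = Quotient.mk _ S := fun q S h =>
    Quotient.sound ((hs q).nonempty_equiv h)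
  have ha : ∀ q q' : HasseArrow (TorsionClass A), lab q = lab q' ↔ ForcingEquiv q q' :=
    fun q q' => by rw [(hs q).forcingEquiv_iff (hs q')]; exact Quotient.eq
  have label_of_eq : ∀ {q q'}, lab q = lab q' → IsLabel q (s q').1 := fun {q q'} h =>
    let ⟨e⟩ := Quotient.exact h
    (hs q).of_equiv (s q').2 e
  have hj : Function.Bijective (fun j : CJIrr (TorsionClass A) => lab j.arrow) :=
    ⟨fun j j' h => Subtype.ext ((label_of_eq h).src_eq_gen.trans (hs j'.arrow).src_eq_gen.symm),
      Quotient.ind fun S => ⟨cjirrOfBrick S, lab_eq _ S (isLabel_cjirrOfBrick S)⟩⟩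
  have hm : Function.Bijective (fun m : CMIrr (TorsionClass A) => lab m.arrow) :=
    ⟨fun m m' h => Subtype.ext
      ((label_of_eq h).tgt_eq_leftPerp.trans (hs m'.arrow).tgt_eq_leftPerp.symm),
      Quotient.ind fun S => ⟨cmirrOfBrick S, lab_eq _ S (isLabel_cmirrOfBrick S)⟩⟩
  have hγ : ∀ q, lab (cjirrOfBrick (s q)).arrow = lab q := fun q =>
    lab_eq _ _ (isLabel_cjirrOfBrick (s q))
  have hμ : ∀ q, lab (cmirrOfBrick (s q)).arrow = lab q := fun q =>
    lab_eq _ _ (isLabel_cmirrOfBrick (s q))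
  refine ⟨lab, fun q => cjirrOfBrick (s q), fun q => cmirrOfBrick (s q), fun q => ?_,
    fun q j => ?_, fun q m => ?_, ha, fun B => (hj.2 B).imp' _ fun _ h => h,
    isCompletelyCongruenceUniform, hj, fun q => ⟨hγ q, (hs q).isLeast_gen⟩, hm,
    fun q => ⟨hμ q, (hs q).isGreatest_leftPerp⟩⟩
  · ext B
    constructor
    · rintro ⟨S, rfl, h1, h2⟩
      exact (lab_eq q S ⟨S.2, h1, h2⟩).symm
    · rintro rfl
      exact ⟨s q, rfl, (hs q).mem_src, (hs q).tgt_le⟩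
  · rw [← ha, ← hγ q]
    exact hj.1.eq_iff
  · rw [← ha, ← hμ q]
    exact hm.1.eq_iff
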